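/- Let $\tau=(E,\le)$ be a preorder (a reflexive and transitive relation) on an $n$-element set $E$. An order ideal of $\tau$ is a subset $I\subseteq E$ such that $b\in I$ and $a\le b$ imply $a\in I$. Let $$\mathcal{Q}_\tau=\Big\{x\in\mathbb{R}^E : x_e\ge 0 \text{ for all } e\in E,\ \sum_{e\in I}x_e\le |I| \text{ for every order ideal } I \text{ of } \tau\Big\}$$ be the preorder polytope of $\tau$. Then $\mathcal{Q}_\tau$ is an $n$-dimensional lattice polytope, that is, it is the convex hull of a finite set, its affine span has dimension $n$, and all its vertices belong to $\mathbb{Z}^E$. Moreover, it is unimodularly equivalent to a $Y$-type generalized permutohedron, which is also a generalized permutohedron. More precisely, there exist a nonempty finite set $F$, nonnegative real numbers $y_I$ and nonnegative real numbers $z_I$, indexed by the nonempty subsets $I$ of $F$, such that the Minkowski sum $$P=\sum_{\varnothing\ne I\subseteq F} y_I\,\Delta_I,\qquad \Delta_I=\mathrm{conv}\{\mathbf{e}_i : i\in I\}\subset\mathbb{R}^F$$ (a $Y$-type generalized permutohedron; here $\mathbf{e}_i$ are the standard basis vectors) satisfies $$P=\Big\{x\in\mathbb{R}^F : \sum_{i\in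 F}x_i=z_F,\ \sum_{i\in I}x_i\ge z_I \text{ for every nonempty } I\subseteq F\Big\}$$ (a generalized permutohedron), and there is an affine map $\varphi:\mathbb{R}^E\to\mathbb{R}^F$ which restricts to a bijection from the affine span $\mathrm{aff}(\mathcal{Q}_\tau)$ to $\mathrm{aff}(P)$, maps $\mathrm{aff}(\mathcal{Q}_\tau)\cap\mathbb{Z}^E$ onto $\mathrm{aff}(P)\cap\mathbb{Z}^F$, and maps $\mathcal{Q}_\tau$ onto $P$. -/

import Mathlib

universe u

namespace PreorderPolytope

section

open scoped Pointwise

/-- The preorder polytope of a preordered finite set `E`: the points `x` of `ℝ^E` with `x ≥ 0` and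
`∑_{e ∈ I} x_e ≤ |I|` for every order ideal (down-closed subset) `I`. -/
def preorderPolytope (E : Type*) [Fintype E] [Preorder E] : Set (E → ℝ) :=
  {x | (∀ e, 0 ≤ x e) ∧
    ∀ I : Finset E, IsLowerSet (I : Set E) → ∑ e ∈ I, x e ≤ (I.card : ℝ)}

/-- The integer lattice `ℤ^E` inside `ℝ^E`. -/
def latticePoints (E : Type*) : Set (E → ℝ) :=
  {x | ∀ e, ∃ k : ℤ, x e = (k : ℝ)}

/-- A polytope is the convex hull of finitely many points. -/
def IsPolytope {E : Type*} (P : Set (E → ℝ)) : Prop :=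
  ∃ S : Set (E → ℝ), S.Finite ∧ P = convexHull ℝ S

/-- A lattice polytope is a polytope all of whose vertices (extreme points) are integer points. -/
def IsLatticePolytope {E : Type*} (P : Set (E → ℝ)) : Prop :=
  IsPolytope P ∧ P.extremePoints ℝ ⊆ latticePoints E

/-- `P` is nonempty and its affine span has dimension `d`. -/
def HasDim {E : Type*} (P : Set (E → ℝ)) (d : ℕ) : Prop :=
  P.Nonempty ∧ Module.finrank ℝ (vectorSpan ℝ P) = d

open Classical in
/-- The standard simplex `Δ_I`: the convex hull of the standard basis vectors indexed by `I`. -/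
noncomputable def simplex {F : Type*} (I : Finset F) : Set (F → ℝ) :=
  convexHull ℝ ((fun i : F => (Pi.single i 1 : F → ℝ)) '' (I : Set F))

/-- The Minkowski sum `∑ y_I Δ_I` over the nonempty subsets `I` of `F`. The sum and the scaling
are the pointwise operations on sets. -/
noncomputable def minkowskiSimplexSum {F : Type*} [Fintype F] (y : Finset F → ℝ) :
    Set (F → ℝ) :=
  ∑ I ∈ Finset.univ.filter (fun I : Finset F => I.Nonempty), y I • simplex I

/-- Y-type generalized permutohedra: Minkowski sums `∑ y_I Δ_I` with nonnegative `y_I`. -/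
def IsYTypeGenPermutohedron {F : Type*} [Fintype F] (P : Set (F → ℝ)) : Prop :=
  ∃ y : Finset F → ℝ, (∀ I, I.Nonempty → 0 ≤ y I) ∧ P = minkowskiSimplexSum y

/-- Generalized permutohedra: the sets given by `∑_{i ∈ F} x_i = z_F` and
`∑_{i ∈ I} x_i ≥ z_I` for all nonempty `I ⊆ F`, with nonnegative `z_I`. -/
def IsGenPermutohedron {F : Type*} [Fintype F] (P : Set (F → ℝ)) : Prop :=
  ∃ z : Finset F → ℝ, (∀ I, I.Nonempty → 0 ≤ z I) ∧
    P = {x | ∑ i, x i = z Finset.univ ∧ ∀ I : Finset F, I.Nonempty → z I ≤ ∑ i ∈ I, x i}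

/-- Unimodular equivalence: an affine map which restricts to a bijection between the affine spans,
carries the lattice points of one affine span onto those of the other, and carries `P` onto `Q`.
(An affine map between the affine spans always extends to the ambient spaces.) -/
def UnimodularlyEquivalent {E F : Type*} (P : Set (E → ℝ)) (Q : Set (F → ℝ)) : Prop :=
  ∃ φ : (E → ℝ) →ᵃ[ℝ] (F → ℝ),
    Set.BijOn φ (affineSpan ℝ P : Set (E → ℝ)) (affineSpan ℝ Q : Set (F → ℝ)) ∧
    φ '' ((affineSpan ℝ P : Set (E → ℝ)) ∩ latticePoints E) =
      (affineSpan ℝ Q : Set (F → ℝ)) ∩ latticePoints F ∧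
    φ '' P = Q

end

end PreorderPolytope

open scoped Pointwise

namespace PreorderPolytope

/-! Appending the slack coordinate `n - ∑ x` embeds the polytope in `ℝ^(Option E)`. Its image is the
Minkowski sum, over `e`, of the simplices on `{none} ∪ {j | e ≤ j}`
(`homogenize_image_preorderPolytope`). Such a sum is cut out by `z_I`, the number of summands
supported in `I` (`sum_simplex_eq`, by separation and a greedy duality argument). For `I` containing
`none`, these inequalities amount to the order ideal inequalities on complements, given `x ≥ 0`. -/

/-! ### Minkowski sums of simplices. -/

theorem simplex_eq_convexHull {F : Type*} [DecidableEq F] (I : Finset F) :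
    simplex I = convexHull ℝ ((fun i : F => (Pi.single i 1 : F → ℝ)) '' (I : Set F)) := by
  rw [simplex]
  congr!

theorem single_mem_simplex {F : Type*} [DecidableEq F] {I : Finset F} {i : F} (hi : i ∈ I) :
    (Pi.single i 1 : F → ℝ) ∈ simplex I := by
  rw [simplex_eq_convexHull]
  exact subset_convexHull ℝ _ ⟨i, hi, rfl⟩

theorem simplex_nonempty {F : Type*} {I : Finset F} (hI : I.Nonempty) : (simplex I).Nonempty := by
  classical
  simpa [simplex, convexHull_nonempty_iff] using hI

theorem convex_simplex {F : Type*} (I : Finset F) : Convex ℝ (simplex I) :=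
  convex_convexHull ℝ _

/-- A point of the simplex `Δ_A` has coordinate sum `1`. -/
theorem sum_eq_one_of_mem_simplex {F : Type*} [Fintype F] {A : Finset F} {x : F → ℝ}
    (hx : x ∈ simplex A) : ∑ i, x i = 1 := by
  classical
  have hlin : IsLinearMap ℝ (fun x : F → ℝ => ∑ i, x i) :=
    ⟨fun x y => by simp [Finset.sum_add_distrib], fun c x => by simp [Finset.mul_sum]⟩
  refine convexHull_min ?_ (convex_hyperplane hlin 1) hx
  rintro _ ⟨i, -, rfl⟩
  simp [Pi.single_apply]

/-- The partial coordinate sums over `I` of a point of `Δ_A` are nonnegative, and at least `1` when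
`A ⊆ I`. -/
theorem indicator_le_sum_of_mem_simplex {F : Type*} [DecidableEq F] {A I : Finset F} {x : F → ℝ}
    (hx : x ∈ simplex A) : (if A ⊆ I then 1 else 0 : ℝ) ≤ ∑ i ∈ I, x i := by
  have hlin : IsLinearMap ℝ (fun x : F → ℝ => ∑ i ∈ I, x i) :=
    ⟨fun x y => by simp [Finset.sum_add_distrib], fun c x => by simp [Finset.mul_sum]⟩
  rw [simplex_eq_convexHull] at hx
  refine convexHull_min ?_ (convex_halfSpace_ge hlin _) hx
  rintro _ ⟨i, hi, rfl⟩
  have hsum : ∑ j ∈ I, (Pi.single i 1 : F → ℝ) j = if i ∈ I then 1 else 0 := by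
    simp [Pi.single_apply]
  rw [Set.mem_ofPred_eq, hsum]
  split_ifs with h1 h2
  · rfl
  · exact absurd (h1 hi) h2
  · exact zero_le_one
  · rfl

/-- A sum of `k` copies of a nonempty convex set is its dilation by `k`. -/
theorem sum_const_eq_card_smul {ι V : Type*} [AddCommGroup V] [Module ℝ V] {s : Set V}
    (hs : Convex ℝ s) (hne : s.Nonempty) (T : Finset ι) :
    ∑ _e ∈ T, s = (T.card : ℝ) • s := by
  classical
  induction T using Finset.induction_on with
  | empty => simp [Set.zero_smul_set hne]
  | insert a T ha ih =>
    rw [Finset.sum_insert ha, ih, Finset.card_insert_of_notMem ha, Nat.cast_add, Nat.cast_one,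
      add_comm (T.card : ℝ) 1, hs.add_smul zero_le_one (Nat.cast_nonneg _), one_smul]

/-- A Minkowski sum of a finite family of simplices is a Y-type generalized permutohedron. -/
theorem isYTypeGenPermutohedron_sum_simplex {ι F : Type*} [Fintype ι] [Fintype F]
    {A : ι → Finset F} (hA : ∀ e, (A e).Nonempty) :
    IsYTypeGenPermutohedron (∑ e, simplex (A e)) := by
  classical
  refine ⟨fun I => ((Finset.univ.filter fun e => A e = I).card : ℝ),
    fun _ _ => Nat.cast_nonneg _, ?_⟩
  rw [minkowskiSimplexSum, ← Finset.sum_fiberwise_of_maps_to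
    (t := Finset.univ.filter fun I : Finset F => I.Nonempty) (g := A) (by simpa using hA)]
  refine Finset.sum_congr rfl fun I hI => ?_
  rw [← sum_const_eq_card_smul (convex_simplex I) (simplex_nonempty (by simpa using hI))]
  refine Finset.sum_congr rfl fun e he => ?_
  rw [(Finset.mem_filter.mp he).2]

/-- A Minkowski sum of simplices is the convex hull of a finite set of integer points. -/
theorem exists_finite_sum_simplex_eq_convexHull {ι F : Type*} [Fintype ι] (A : ι → Finset F) :
    ∃ T : Set (F → ℝ), T.Finite ∧ T ⊆ latticePoints F ∧ ∑ e, simplex (A e) = convexHull ℝ T := by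
  classical
  refine ⟨∑ e, (fun i : F => (Pi.single i 1 : F → ℝ)) '' (A e : Set F), ?_, ?_, ?_⟩
  · refine Finset.sum_induction _ Set.Finite (fun _ _ => Set.Finite.add) (Set.finite_singleton 0) ?_
    exact fun e _ => (A e).finite_toSet.image _
  · intro x hx i
    obtain ⟨g, hg, rfl⟩ := (Set.mem_fintype_sum _ _).mp hx
    choose s hs hgs using hg
    -- Coordinate `i` counts the summands whose chosen vertex is `i`.
    refine ⟨∑ e, if i = s e then 1 else 0, ?_⟩
    simp [← hgs, Pi.single_apply]
  · rw [convexHull_sum]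
    rfl

/-- Weak duality for the inequality description of a Minkowski sum of simplices: if `x` satisfies
the inequalities and `m e` is at most the minimum of `c ≥ 0` on `A e`, then `∑ m ≤ ⟨c, x⟩`. -/
theorem sum_le_sum_mul_of_nonneg {ι F : Type*} [Fintype ι] [Fintype F] [DecidableEq F]
    {A : ι → Finset F} {x : F → ℝ}
    (hx : ∀ I : Finset F, ((Finset.univ.filter fun e => A e ⊆ I).card : ℝ) ≤ ∑ i ∈ I, x i)
    (c : F → ℝ) (hc : ∀ i, 0 ≤ c i) (m : ι → ℝ) (hA : ∀ e, (A e).Nonempty)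
    (hm : ∀ e, ∀ i ∈ A e, m e ≤ c i) :
    ∑ e, m e ≤ ∑ i, c i * x i := by
  -- Induction on the support `S` of `c`: subtract its least value `t` there, which shrinks the
  -- support. Each `m e` with `A e ⊆ S` drops by `t`, and the loss is covered by `t` times the
  -- inequality for `S`.
  induction hk : (Finset.univ.filter fun i => c i ≠ 0).card using Nat.strong_induction_on
    generalizing c m with
  | _ k ih =>
  set S : Finset F := Finset.univ.filter fun i => c i ≠ 0 with hS
  rcases S.eq_empty_or_nonempty with h0 | hne
  · have hc0 : ∀ i, c i = 0 := fun i => by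
      by_contra h
      exact Finset.notMem_empty i (h0 ▸ by simpa [hS] using h)
    simp only [hc0, zero_mul, Finset.sum_const_zero]
    refine Finset.sum_nonpos fun e _ => ?_
    obtain ⟨i, hi⟩ := hA e
    simpa [hc0] using hm e i hi
  · obtain ⟨i₀, hi₀, hmin⟩ := S.exists_min_image c hne
    have hi₀' : c i₀ ≠ 0 := by simpa [hS] using hi₀
    set t := c i₀ with ht
    have ht0 : 0 ≤ t := hc i₀
    have hz : ∀ i, i ∉ S → c i = 0 := fun i hi => by simpa [hS] using hi
    have hc' : ∀ i, 0 ≤ c i - if i ∈ S then t else 0 := fun i => by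
      split_ifs with h
      · linarith [hmin i h]
      · linarith [hc i]
    have := ih _ ?_ (fun i => c i - if i ∈ S then t else 0) hc'
      (fun e => m e - if A e ⊆ S then t else 0) ?_ rfl
    · simp only [Finset.sum_sub_distrib, sub_mul, ite_mul, zero_mul] at this
      rw [← Finset.sum_filter, Finset.sum_const, nsmul_eq_mul, ← Finset.sum_filter,
        Finset.filter_univ_mem, ← Finset.mul_sum] at this
      nlinarith [mul_le_mul_of_nonneg_left (hx S) ht0]
    · rw [← hk]
      refine Finset.card_lt_card ((Finset.ssubset_iff_of_subset ?_).mpr ⟨i₀, hi₀, by simp [hi₀, ht]⟩)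
      intro i hi
      by_contra h
      simp [h, hz i h] at hi
    · intro e i hi
      by_cases h : A e ⊆ S
      · simpa [h, h hi] using hm e i hi
      -- Here `c` vanishes at some `j ∈ A e`, so `m e ≤ 0` already.
      · obtain ⟨j, hj, hjS⟩ := Finset.not_subset.mp h
        have := hm e j hj
        rw [hz j hjS] at this
        simpa [h] using this.trans (hc' i)

/-- The inequality description of a Minkowski sum of simplices. -/
theorem sum_simplex_eq {ι F : Type*} [Fintype ι] [Fintype F] [DecidableEq F]
    {A : ι → Finset F} (hA : ∀ e, (A e).Nonempty) :
    ∑ e, simplex (A e) = {x | ∑ i, x i = (Fintype.card ι : ℝ) ∧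
      ∀ I : Finset F, I.Nonempty →
        ((Finset.univ.filter fun e => A e ⊆ I).card : ℝ) ≤ ∑ i ∈ I, x i} := by
  ext x
  constructor
  · intro hx
    obtain ⟨g, hg, rfl⟩ := (Set.mem_fintype_sum _ _).mp hx
    simp only [Set.mem_ofPred_eq, Finset.sum_apply]
    constructor
    · rw [Finset.sum_comm]
      simp [sum_eq_one_of_mem_simplex (hg _)]
    · intro I _
      rw [Finset.sum_comm, Finset.card_filter, Nat.cast_sum]
      refine Finset.sum_le_sum fun e _ => ?_
      simpa using indicator_le_sum_of_mem_simplex (I := I) (hg e)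
  · rintro ⟨hsum, hx⟩
    by_contra hmem
    obtain ⟨T, hT, -, hTeq⟩ := exists_finite_sum_simplex_eq_convexHull A
    rw [hTeq] at hmem
    obtain ⟨f, u, hfx, hfu⟩ := geometric_hahn_banach_point_closed (convex_convexHull ℝ T)
      (hT.isClosed_convexHull ℝ) hmem
    rw [← hTeq] at hfu
    set c : F → ℝ := fun i => f (Pi.single i 1)
    have hf : ∀ y : F → ℝ, f y = ∑ i, c i * y i := fun y => by
      conv_lhs => rw [pi_eq_sum_univ' y, map_sum]
      refine Finset.sum_congr rfl fun i _ => ?_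
      rw [map_smul, smul_eq_mul, mul_comm]
    -- The separating functional is minimized on the sum by taking a cheapest vertex in each
    -- simplex.
    choose s hs hmin using fun e => (A e).exists_min_image c (hA e)
    have hb : ∑ e, (Pi.single (s e) 1 : F → ℝ) ∈ ∑ e, simplex (A e) :=
      (Set.mem_fintype_sum _ _).mpr
        ⟨fun e => Pi.single (s e) 1, fun e => single_mem_simplex (hs e), rfl⟩
    have hlt : f x < ∑ e, c (s e) := hfx.trans (by simpa using hfu _ hb)
    -- Weak duality needs `c ≥ 0`. Shifting by `l` is harmless: as `∑ x = card ι`, both sides change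
    -- by `l * card ι`.
    obtain ⟨l, hl⟩ : ∃ l : ℝ, ∀ i, l ≤ c i := by
      obtain ⟨l, hl⟩ := (Set.finite_range c).bddBelow
      exact ⟨l, fun i => hl ⟨i, rfl⟩⟩
    have hx' : ∀ I : Finset F,
        ((Finset.univ.filter fun e => A e ⊆ I).card : ℝ) ≤ ∑ i ∈ I, x i := by
      intro I
      rcases I.eq_empty_or_nonempty with rfl | hI
      · simp [Finset.subset_empty, (hA _).ne_empty]
      · exact hx I hI
    have := sum_le_sum_mul_of_nonneg hx' (fun i => c i - l) (fun i => sub_nonneg.mpr (hl i))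
      (fun e => c (s e) - l) hA fun e i hi => sub_le_sub_right (hmin e i hi) l
    simp only [Finset.sum_sub_distrib, sub_mul, ← Finset.mul_sum, hsum] at this
    simp only [Finset.sum_const, Finset.card_univ, nsmul_eq_mul] at this
    rw [hf] at hlt
    linarith

/-- A Minkowski sum of a finite family of simplices is a generalized permutohedron. -/
theorem isGenPermutohedron_sum_simplex {ι F : Type*} [Fintype ι] [Fintype F]
    {A : ι → Finset F} (hA : ∀ e, (A e).Nonempty) :
    IsGenPermutohedron (∑ e, simplex (A e)) := by
  classical
  refine ⟨fun I => ((Finset.univ.filter fun e => A e ⊆ I).card : ℝ),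
    fun _ _ => Nat.cast_nonneg _, ?_⟩
  rw [sum_simplex_eq hA]
  simp [Finset.card_univ]

/-! ### Homogenization as a unimodular equivalence. -/

section Homogenization

variable {E : Type*} [Fintype E]

/-- The affine embedding `x ↦ (x, N - ∑ x)` of `ℝ^E` into `ℝ^(E ∪ {none})`. -/
noncomputable def homogenize (N : ℝ) : (E → ℝ) →ᵃ[ℝ] (Option E → ℝ) where
  toFun x i := i.elim (N - ∑ e, x e) x
  linear :=
    { toFun := fun x i => i.elim (-∑ e, x e) x
      map_add' := fun x y => by
        ext (_ | i) <;> simp [Finset.sum_add_distrib, add_comm]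
      map_smul' := fun r x => by
        ext (_ | i) <;> simp [Finset.mul_sum] }
  map_vadd' x v := by
    ext (_ | i) <;> simp [Finset.sum_add_distrib]
    ring

@[simp] theorem homogenize_none (N : ℝ) (x : E → ℝ) : homogenize N x none = N - ∑ e, x e := rfl

@[simp] theorem homogenize_some (N : ℝ) (x : E → ℝ) (e : E) : homogenize N x (some e) = x e := rfl

theorem homogenize_injective (N : ℝ) : Function.Injective (homogenize N : (E → ℝ) → _) :=
  fun x y h => funext fun e => by simpa using congrFun h (some e)

theorem homogenize_mem_latticePoints_iff {N : ℤ} {x : E → ℝ} :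
    homogenize (N : ℝ) x ∈ latticePoints (Option E) ↔ x ∈ latticePoints E := by
  constructor
  · exact fun h e => h (some e)
  · rintro h (_ | e)
    · choose k hk using h
      exact ⟨N - ∑ e, k e, by simp [hk]⟩
    · exact h e

/-- Homogenization is a unimodular equivalence. -/
theorem unimodularlyEquivalent_homogenize (N : ℤ) (Q : Set (E → ℝ)) :
    UnimodularlyEquivalent Q (homogenize (N : ℝ) '' Q) := by
  refine ⟨homogenize N, ?_, ?_, rfl⟩
  · rw [← AffineSubspace.map_span, AffineSubspace.coe_map]
    exact (homogenize_injective _).injOn.bijOn_image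
  · rw [← AffineSubspace.map_span, AffineSubspace.coe_map]
    ext y
    constructor
    · rintro ⟨x, ⟨hx, hl⟩, rfl⟩
      exact ⟨⟨x, hx, rfl⟩, homogenize_mem_latticePoints_iff.mpr hl⟩
    · rintro ⟨⟨x, hx, rfl⟩, hl⟩
      exact ⟨x, ⟨hx, homogenize_mem_latticePoints_iff.mp hl⟩, rfl⟩

end Homogenization

/-! ### The preorder polytope as a sum of simplices. -/

section Preorder

variable (E : Type*) [Fintype E] [Preorder E]

open Classical in
/-- The principal filter of `e` in `E`, together with the extra point `none`. -/
noncomputable def pointedFilter {E : Type*} [Fintype E] [Preorder E] (e : E) :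
    Finset (Option E) :=
  Finset.univ.filter fun i => ∀ j, i = some j → e ≤ j

theorem pointedFilter_nonempty {E : Type*} [Fintype E] [Preorder E] (e : E) :
    (pointedFilter e).Nonempty :=
  ⟨none, by simp [pointedFilter]⟩

theorem pointedFilter_subset_iff {E : Type*} [Fintype E] [Preorder E] {e : E}
    {I : Finset (Option E)} : pointedFilter e ⊆ I ↔ none ∈ I ∧ ∀ j, e ≤ j → some j ∈ I := by
  simp [pointedFilter, Finset.subset_iff, Option.forall]

/-- The homogenized preorder polytope is a Minkowski sum of simplices. -/
theorem homogenize_image_preorderPolytope :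
    homogenize (Fintype.card E : ℝ) '' preorderPolytope E = ∑ e : E, simplex (pointedFilter e) := by
  classical
  rw [sum_simplex_eq pointedFilter_nonempty]
  have hcard : ∀ D : Finset E, (Dᶜ.card : ℝ) = Fintype.card E - D.card := fun D => by
    rw [Finset.card_compl, Nat.cast_sub (Finset.card_le_univ D)]
  ext y
  constructor
  · rintro ⟨x, ⟨hx0, hx⟩, rfl⟩
    refine ⟨by simp [Fintype.sum_option], fun I _ => ?_⟩
    by_cases hI : none ∈ I
    -- `D` is the order ideal generated by the elements missing from `I`; its complement indexes the
    -- simplices supported in `I`.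
    · set D : Finset E := Finset.univ.filter fun e => ∃ j, e ≤ j ∧ some j ∉ I with hD
      have hDlow : IsLowerSet (D : Set E) := by
        intro a b hba ha
        obtain ⟨j, hj, hjI⟩ : ∃ j, a ≤ j ∧ some j ∉ I := by simpa [hD] using ha
        simpa [hD] using ⟨j, hba.trans hj, hjI⟩
      have hcount : (Finset.univ.filter fun e : E => pointedFilter e ⊆ I) = Dᶜ := by
        ext e
        simp [hD, pointedFilter_subset_iff, hI]
      have hsum : ∑ i ∈ I, homogenize (Fintype.card E : ℝ) x i
          = Fintype.card E - ∑ e ∈ Finset.univ.filter (fun e => some e ∉ I), x e := by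
        rw [← Finset.filter_univ_mem I, Finset.sum_filter, Fintype.sum_option]
        simp only [hI, if_true, homogenize_none, homogenize_some, Finset.filter_univ_mem]
        rw [← Finset.sum_filter, ← Finset.sum_filter_add_sum_filter_not Finset.univ
          (fun e => some e ∈ I) x]
        ring
      have hle : ∑ e ∈ Finset.univ.filter (fun e => some e ∉ I), x e ≤ ∑ e ∈ D, x e :=
        Finset.sum_le_sum_of_subset_of_nonneg
          (fun e he => by simpa [hD] using ⟨e, le_rfl, by simpa using he⟩) fun e _ _ => hx0 e
      rw [hcount, hcard, hsum]
      linarith [hx D hDlow]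
    · have hcount : (Finset.univ.filter fun e : E => pointedFilter e ⊆ I) = ∅ := by
        ext e
        simp [pointedFilter_subset_iff, hI]
      rw [hcount, Finset.card_empty, Nat.cast_zero]
      refine Finset.sum_nonneg ?_
      rintro (_ | e) hi
      · exact absurd hi hI
      · exact hx0 e
  · rintro ⟨hsum, hy⟩
    rw [Fintype.sum_option] at hsum
    refine ⟨fun e => y (some e), ⟨fun e => ?_, fun D hD => ?_⟩, ?_⟩
    · simpa using (Nat.cast_nonneg _).trans (hy {some e} (Finset.singleton_nonempty _))
    -- Since `D` is an ideal, `Dᶜ` is a filter, so exactly the simplices of `e ∉ D` lie in this set.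
    · have := hy (insert none (Dᶜ.image some)) (Finset.insert_nonempty _ _)
      have hcount : (Finset.univ.filter fun e : E =>
          pointedFilter e ⊆ insert none (Dᶜ.image some)) = Dᶜ := by
        ext e
        simp only [Finset.mem_filter, Finset.mem_univ, true_and, pointedFilter_subset_iff,
          Finset.mem_compl]
        refine ⟨fun h => by simpa using h.2 e le_rfl, fun h => ⟨by simp, fun j hj => ?_⟩⟩
        simpa using fun hjD : j ∈ D => h (hD hj hjD)
      rw [hcount, hcard, Finset.sum_insert (by simp),
        Finset.sum_image (Option.some_injective E).injOn] at this
      linarith [Finset.sum_add_sum_compl D fun e => y (some e)]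
    · ext (_ | e)
      · rw [homogenize_none]
        linarith
      · rfl

theorem isLatticePolytope_preorderPolytope : IsLatticePolytope (preorderPolytope E) := by
  obtain ⟨T, hT, hTl, hTeq⟩ :=
    exists_finite_sum_simplex_eq_convexHull (pointedFilter : E → Finset (Option E))
  -- Forgetting the `none` coordinate undoes `homogenize` and preserves integrality.
  have hQ : preorderPolytope E = convexHull ℝ (LinearMap.funLeft ℝ ℝ (some : E → _) '' T) := by
    rw [← LinearMap.image_convexHull, ← hTeq, ← homogenize_image_preorderPolytope, Set.image_image]
    exact (Set.image_id' _).symm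
  refine ⟨⟨_, hT.image _, hQ⟩, ?_⟩
  rw [hQ]
  refine extremePoints_convexHull_subset.trans ?_
  rintro _ ⟨y, hy, rfl⟩ e
  exact hTl hy (some e)

theorem hasDim_preorderPolytope : HasDim (preorderPolytope E) (Fintype.card E) := by
  classical
  have h0 : (0 : E → ℝ) ∈ preorderPolytope E :=
    ⟨fun _ => le_rfl, fun I _ => by simp⟩
  have h1 : ∀ e, (Pi.single e 1 : E → ℝ) ∈ preorderPolytope E := fun e => by
    refine ⟨fun i => ?_, fun I _ => ?_⟩
    · rw [Pi.single_apply]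
      positivity
    · rw [Finset.card_eq_sum_ones, Nat.cast_sum]
      refine Finset.sum_le_sum fun i _ => ?_
      rw [Pi.single_apply]
      split_ifs <;> simp
  refine ⟨⟨0, h0⟩, ?_⟩
  have htop : vectorSpan ℝ (preorderPolytope E) = ⊤ := by
    rw [eq_top_iff, ← (Pi.basisFun ℝ E).span_eq, Submodule.span_le]
    rintro _ ⟨e, rfl⟩
    simpa using vsub_mem_vectorSpan ℝ (h1 e) h0
  rw [htop, finrank_top, Module.finrank_fintype_fun_eq_card]

end Preorder

end PreorderPolytope

theorem theorem1p3 {E : Type u} [Fintype E] [Preorder E] (n : ℕ) (hn : Fintype.card E = n) :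
    PreorderPolytope.HasDim (PreorderPolytope.preorderPolytope E) n ∧
    PreorderPolytope.IsLatticePolytope (PreorderPolytope.preorderPolytope E) ∧
    ∃ (F : Type u) (_ : Fintype F) (_ : Nonempty F) (P : Set (F → ℝ)),
      PreorderPolytope.IsYTypeGenPermutohedron P ∧
      PreorderPolytope.IsGenPermutohedron P ∧
      PreorderPolytope.UnimodularlyEquivalent (PreorderPolytope.preorderPolytope E) P := by
  subst hn
  refine ⟨PreorderPolytope.hasDim_preorderPolytope E,
    PreorderPolytope.isLatticePolytope_preorderPolytope E, Option E, inferInstance, ⟨none⟩, _,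
    PreorderPolytope.isYTypeGenPermutohedron_sum_simplex PreorderPolytope.pointedFilter_nonempty,
    PreorderPolytope.isGenPermutohedron_sum_simplex PreorderPolytope.pointedFilter_nonempty, ?_⟩
  rw [← PreorderPolytope.homogenize_image_preorderPolytope]
  exact_mod_cast PreorderPolytope.unimodularlyEquivalent_homogenize (Fintype.card E : ℤ)
    (PreorderPolytope.preorderPolytope E)
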